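/- Let $\Sigma$ be a totally ordered alphabet. A word $T\in\Sigma^*$ is primitive if $T=U^k$ with $U \in \Sigma^*$, $k\ge 1$ implies $U=T$ and $k=1$ (so the empty word is not primitive). For nonempty words $S,T$ write $S\prec_{\mathrm{alt}}T$ if the infinite repetitions $S^\omega, T^\omega$ differ and, at their first mismatch $j$ (positions counted from $1$), either $j$ is odd and $S^\omega[j]<T^\omega[j]$, or $j$ is even and $S^\omega[j]>T^\omega[j]$. A nonempty word $W$ is Galois if $W\prec_{\mathrm{alt}}VU$ for every factorization $W=UV$ with $U,V$ nonempty. A Galois rotation of $T$ is a cyclic rotation $VU$ of $T=UV$ that is Galois. **Theorem.** Every primitive word $T$ has exactly one Galois rotation, and it can be computed in $O(|T|)$ time with $O(1)$ additional working space. Precisely: there are one program, independent of the alphabet and of the input, and one constant $C$ such that, for every totally ordered alphabet and every primitive word $T$ over it, given read-only access to $T$ and the number $|T|$, the program halts after at most $C|T|$ steps, having written the Galois rotation $W$ of $T$ to a write-only output and returning in a register the offset $k\in\{0,\dots,|T|-1\}$ for which $W=T[k+1..|T|]\,T[1..k]$. The program runs on a random access machine with unit-cost instructions. Its only working memory is a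 number of registers fixed by the program, which hold natural numbers that never exceed $C|T|$ (so $O(1)$ machine words of $\log_2|T|+O(1)$ bits). Its instructions load a constant, add, subtract (truncated at $0$), compare two registers, compare the input symbols at two positions given by registers, and copy the input symbol at a position given by a register to the output. -/

import Mathlib

namespace GaloisWord

/-! ### Words, the alternating order, and Galois words

Words over an alphabet `α` are lists; positions are counted from `0`. -/

section Words

variable {α : Type*}

/-- A word `V` is primitive if `V = U ^ k` with `k ≥ 1` is only possible for `U = V`, `k = 1`.
The empty word is not primitive, since it equals its own square. -/
def IsPrimitive (V : List α) : Prop :=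
  ∀ (U : List α) (k : ℕ), 1 ≤ k → V = (List.replicate k U).flatten → U = V ∧ k = 1

/-- The infinite repetition of a nonempty word. -/
def omegaPow (S : List α) (hS : S ≠ []) (i : ℕ) : α :=
  S[i % S.length]'(Nat.mod_lt _ (List.length_pos_iff.mpr hS))

/-- The (strict) alternating order. For nonempty words, the infinite repetitions are compared at
their first mismatch `j`: in the order of the alphabet if `j` is even and in the opposite order
if `j` is odd (as positions start at `0`, even `j` are the odd positions when counting from `1`).
The empty word is larger than every nonempty word. -/
def AltLT [LinearOrder α] (S T : List α) : Prop :=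
  (S ≠ [] ∧ T = []) ∨
  ∃ (hS : S ≠ []) (hT : T ≠ []) (j : ℕ),
    (∀ i < j, omegaPow S hS i = omegaPow T hT i) ∧
    ((Even j ∧ omegaPow S hS j < omegaPow T hT j) ∨
     (Odd j ∧ omegaPow T hT j < omegaPow S hS j))

/-- A nonempty word is Galois if it is strictly smaller, in the alternating order, than all its
other cyclic rotations `V ++ U`, where `W = U ++ V` with `U`, `V` nonempty. -/
def IsGalois [LinearOrder α] (W : List α) : Prop :=
  W ≠ [] ∧ ∀ U V : List α, U ≠ [] → V ≠ [] → W = U ++ V → AltLT W (V ++ U)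

/-- `W` is a Galois rotation of `T`: a cyclic rotation of `T` that is Galois. -/
def IsGaloisRotation [LinearOrder α] (T W : List α) : Prop :=
  T ~r W ∧ IsGalois W

end Words

/-! ### The machine model

A random access machine over a read-only input word. It has a finite control and finitely many
registers, which hold natural numbers. The symbols of the input can only be compared with each
other, and copied to a write-only output. Every instruction takes one unit of time. -/

/-- Instructions over labels `L` and registers `R`; the label arguments say where to continue. -/
inductive Instr (L R : Type) : Type
  /-- Stop. -/
  | halt : Instr L R
  /-- `d := k` for a constant `k`. -/
  | const (d : R) (k : ℕ) (next : L) : Instr L R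
  /-- `d := a + b`. -/
  | add (d a b : R) (next : L) : Instr L R
  /-- `d := max (a - b) 0`. -/
  | sub (d a b : R) (next : L) : Instr L R
  /-- Compare the contents of the registers `a` and `b`, and continue accordingly. -/
  | cmpReg (a b : R) (lt eq gt : L) : Instr L R
  /-- Compare the input symbols at the positions held by `a` and `b`, and continue
  accordingly. -/
  | cmpSym (a b : R) (lt eq gt : L) : Instr L R
  /-- Append the input symbol at the position held by `a` to the output. -/
  | emit (a : R) (next : L) : Instr L R

/-- A program: finitely many labels and registers, and one instruction for each label. It does not
mention an alphabet or an input. `posReg` is the register in which a position is returned. -/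
structure Program : Type 1 where
  Label : Type
  Reg : Type
  [finiteLabel : Finite Label]
  [finiteReg : Finite Reg]
  [decEqReg : DecidableEq Reg]
  code : Label → Instr Label Reg
  start : Label
  lenReg : Reg
  posReg : Reg

attribute [instance] Program.finiteLabel Program.finiteReg Program.decEqReg

/-- A configuration: the current label, the contents of the registers, the output so far. -/
structure Config (P : Program) (α : Type*) where
  label : P.Label
  reg : P.Reg → ℕ
  out : List α

namespace Program

variable {α : Type*}

/-- Initially all registers are `0`, except that `lenReg` holds the length of the input. -/
def init (P : Program) (T : List α) : Config P α where
  label := P.start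
  reg := Function.update (fun _ => 0) P.lenReg T.length
  out := []

/-- The label at which a comparison with the given result continues. -/
def select {L : Type} (o : Ordering) (lt eq gt : L) : L :=
  match o with
  | .lt => lt
  | .eq => eq
  | .gt => gt

/-- One step on input `T`. There is no next configuration if the machine has stopped, or if it
tries to read outside of the input. -/
def step [LinearOrder α] (P : Program) (T : List α) (c : Config P α) : Option (Config P α) :=
  match P.code c.label with
  | .halt => none
  | .const d k next => some ⟨next, Function.update c.reg d k, c.out⟩
  | .add d a b next => some ⟨next, Function.update c.reg d (c.reg a + c.reg b), c.out⟩
  | .sub d a b next => some ⟨next, Function.update c.reg d (c.reg a - c.reg b), c.out⟩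
  | .cmpReg a b lt eq gt =>
      some ⟨select (compare (c.reg a) (c.reg b)) lt eq gt, c.reg, c.out⟩
  | .cmpSym a b lt eq gt =>
      match T[c.reg a]?, T[c.reg b]? with
      | some x, some y => some ⟨select (compare x y) lt eq gt, c.reg, c.out⟩
      | _, _ => none
  | .emit a next =>
      match T[c.reg a]? with
      | some x => some ⟨next, c.reg, c.out ++ [x]⟩
      | none => none

/-- The configuration after `t` steps on input `T`, if there is one. -/
def run [LinearOrder α] (P : Program) (T : List α) : ℕ → Option (Config P α)
  | 0 => some (P.init T)
  | t + 1 => (P.run T t).bind (P.step T)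

/-- On input `T`, the program stops after exactly `t` steps (by a `halt` instruction, not by an
illegal access), in configuration `c`. -/
def HaltsAt [LinearOrder α] (P : Program) (T : List α) (t : ℕ) (c : Config P α) : Prop :=
  P.run T t = some c ∧ P.code c.label = .halt

/-- All numbers held in registers during the first `t` steps on input `T` are at most `B`. -/
def RegsBounded [LinearOrder α] (P : Program) (T : List α) (t B : ℕ) : Prop :=
  ∀ s ≤ t, ∀ c, P.run T s = some c → ∀ r, c.reg r ≤ B

end Program

end GaloisWord

/-! Let `x` be the infinite repetition of `T` and `n = |T|`. The rotations of `T` are read off the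
tails of `x`, and the alternating order is a strict total order on infinite words. A start whose
tail is minimal gives the Galois rotation: primitivity excludes an equal tail at any start not
congruent modulo `n`, so the minimum is strict (`IsPrimitive.isGalois_rotate`). Asymmetry gives
uniqueness (`IsGalois.eq_of_isRotated`).

The usual two-pointer search for a least rotation relies on this: if tail `i` beats tail `j` at
mismatch `k`, then tail `i + d` beats tail `j + d` for all `d ≤ k`. Here an odd shift reverses the
order, but an even shift preserves it (`AltLTAt.tail_add`). So the even and the odd starts are
searched separately, and the two winners are compared once. Since `2 * n` is an even period, each
class has a minimal start below `2 * n`, whatever the parity of `n` (`exists_isFirstMin`).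

Within one class let `m` be its first minimal start. The invariant is `m = i ∨ j ≤ m`, with `i < j`
and `k` agreeing symbols. At a mismatch, every start of the class within distance `k` behind the
loser is discarded (`skip_right`, `skip_left`). After `n` agreements the tails coincide, which
forces `m = i` (`eq_of_tail_eq`). Each round raises `i + j + k`, which stays below `5 * n`, so the
search is linear (`reach_search`). -/

namespace GaloisWord

/-! ### Tails of periodic words and the alternating order -/

section AlternatingOrder

variable {α : Type*}

/-- The infinite word `x` without its first `p` symbols. -/
def tail (x : ℕ → α) (p : ℕ) (t : ℕ) : α := x (p + t)

/-- Both tails inherit the period `n`. This is what allows a comparison to stop after `|T|` agreeing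
symbols. -/
theorem tail_eq_of_periodic {x : ℕ → α} {n : ℕ} (hn : 0 < n) (hx : Function.Periodic x n)
    {p q : ℕ} (h : ∀ t < n, x (p + t) = x (q + t)) : tail x p = tail x q := by
  funext t
  have hp : ∀ p, x (p + t) = x (p + t % n) := fun p => by
    conv_lhs => rw [← Nat.mod_add_div' t n, ← add_assoc]
    exact hx.nat_mul (t / n) _
  simp only [tail]
  rw [hp p, hp q, h _ (Nat.mod_lt _ hn)]

theorem tail_mod {x : ℕ → α} {n : ℕ} (hx : Function.Periodic x n) (p : ℕ) :
    tail x (p % n) = tail x p := by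
  funext t
  have := hx.nat_mul (p / n) (p % n + t)
  rw [tail, tail, ← this]
  congr 1
  have := Nat.mod_add_div' p n
  push_cast
  omega

variable [LinearOrder α]

/-- `f` precedes `g` in the alternating order, with first mismatch at position `j`. -/
def AltLTAt (f g : ℕ → α) (j : ℕ) : Prop :=
  (∀ i < j, f i = g i) ∧ ((Even j ∧ f j < g j) ∨ (Odd j ∧ g j < f j))

/-- The alternating order on infinite words. -/
def SeqAltLT (f g : ℕ → α) : Prop := ∃ j, AltLTAt f g j

theorem AltLTAt.ne {f g : ℕ → α} {j : ℕ} (h : AltLTAt f g j) : f j ≠ g j := by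
  rcases h.2 with h | h
  · exact h.2.ne
  · exact h.2.ne'

theorem SeqAltLT.irrefl (f : ℕ → α) : ¬ SeqAltLT f f := fun ⟨_, h⟩ => h.ne rfl

theorem SeqAltLT.trans {f g h : ℕ → α} : SeqAltLT f g → SeqAltLT g h → SeqAltLT f h := by
  rintro ⟨j, hj, hj'⟩ ⟨k, hk, hk'⟩
  rcases lt_trichotomy j k with hjk | rfl | hjk
  · exact ⟨j, fun i hi => (hj i hi).trans (hk i (hi.trans hjk)), by rwa [← hk j hjk]⟩
  · refine ⟨j, fun i hi => (hj i hi).trans (hk i hi), ?_⟩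
    rcases hj' with ⟨he, h1⟩ | ⟨ho, h1⟩ <;> rcases hk' with ⟨he', h2⟩ | ⟨ho', h2⟩
    · exact .inl ⟨he, h1.trans h2⟩
    · exact absurd he (Nat.not_even_iff_odd.mpr ho')
    · exact absurd he' (Nat.not_even_iff_odd.mpr ho)
    · exact .inr ⟨ho, h2.trans h1⟩
  · exact ⟨k, fun i hi => (hj i (hi.trans hjk)).trans (hk i hi), by rwa [hj k hjk]⟩

theorem SeqAltLT.asymm {f g : ℕ → α} (h : SeqAltLT f g) : ¬ SeqAltLT g f :=
  fun h' => SeqAltLT.irrefl f (h.trans h')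

theorem altLTAt_or_altLTAt {f g : ℕ → α} {j : ℕ} (h : ∀ i < j, f i = g i) (hj : f j ≠ g j) :
    AltLTAt f g j ∨ AltLTAt g f j := by
  have h' : ∀ i < j, g i = f i := fun i hi => (h i hi).symm
  rcases Nat.even_or_odd j with he | ho <;> rcases lt_or_gt_of_ne hj with hlt | hlt
  · exact .inl ⟨h, .inl ⟨he, hlt⟩⟩
  · exact .inr ⟨h', .inl ⟨he, hlt⟩⟩
  · exact .inr ⟨h', .inr ⟨ho, hlt⟩⟩
  · exact .inl ⟨h, .inr ⟨ho, hlt⟩⟩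

theorem seqAltLT_or_seqAltLT {f g : ℕ → α} (h : f ≠ g) : SeqAltLT f g ∨ SeqAltLT g f := by
  classical
  have hex : ∃ j, f j ≠ g j := Function.ne_iff.mp h
  rcases altLTAt_or_altLTAt (fun i hi => not_not.mp (Nat.find_min hex hi))
    (Nat.find_spec hex) with h | h
  · exact .inl ⟨_, h⟩
  · exact .inr ⟨_, h⟩

/-- Dropping an even number of agreeing symbols moves the mismatch to `k - e`, which has the parity
of `k`, so the same side still wins. An odd shift would swap the winner; hence the split of the
starts by parity. -/
theorem AltLTAt.tail_add {x : ℕ → α} {p q k e : ℕ} (h : AltLTAt (tail x p) (tail x q) k)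
    (he : Even e) (hek : e ≤ k) : SeqAltLT (tail x (p + e)) (tail x (q + e)) := by
  obtain ⟨d, rfl⟩ := Nat.exists_eq_add_of_le hek
  refine ⟨d, fun i hi => ?_, ?_⟩
  · simpa [tail, add_assoc] using h.1 (e + i) (by omega)
  · simpa [tail, add_assoc, Nat.even_add, Nat.odd_add, he, ← Nat.not_even_iff_odd] using h.2

/-- The start `m` is minimal among the starts of its parity. -/
def IsParityMin (x : ℕ → α) (m : ℕ) : Prop :=
  ∀ p, p % 2 = m % 2 → ¬ SeqAltLT (tail x p) (tail x m)

/-- The start `m` is the first minimal one among those of parity `s`. -/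
structure IsFirstMin (x : ℕ → α) (s m : ℕ) : Prop where
  parity : m % 2 = s % 2
  isMin : IsParityMin x m
  first : ∀ m', m' % 2 = s % 2 → IsParityMin x m' → m ≤ m'

theorem exists_forall_not_seqAltLT {ι : Type*} (S : Finset ι) (hS : S.Nonempty)
    (f : ι → ℕ → α) : ∃ a ∈ S, ∀ b ∈ S, ¬ SeqAltLT (f b) (f a) := by
  classical
  induction hS using Finset.Nonempty.cons_induction with
  | singleton a => exact ⟨a, by simp, by simpa using SeqAltLT.irrefl _⟩
  | cons a S ha hS ih =>
    obtain ⟨c, hc, hmin⟩ := ih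
    by_cases h : SeqAltLT (f a) (f c)
    · refine ⟨a, by simp, fun b hb hlt => ?_⟩
      rcases Finset.mem_cons.mp hb with rfl | hb
      · exact SeqAltLT.irrefl _ hlt
      · exact hmin b hb (hlt.trans h)
    · refine ⟨c, by simp [hc], fun b hb => ?_⟩
      rcases Finset.mem_cons.mp hb with rfl | hb
      · exact h
      · exact hmin b hb

/-- The period `2 * n` is even, so reduction modulo it keeps both the tail and the parity of a
start. Reduction modulo an odd `n` would not keep the parity. -/
theorem exists_isFirstMin {x : ℕ → α} {n : ℕ} (hn : 0 < n) (hx : Function.Periodic x n)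
    (s : ℕ) : ∃ m < 2 * n, IsFirstMin x s m := by
  classical
  have hx2 : Function.Periodic x (2 * n) := by simpa using hx.nat_mul 2
  have hne : ((Finset.range (2 * n)).filter (fun p => p % 2 = s % 2)).Nonempty :=
    ⟨s % 2, by simp; omega⟩
  obtain ⟨a, ha, hmin⟩ := exists_forall_not_seqAltLT _ hne (tail x)
  simp only [Finset.mem_filter, Finset.mem_range] at ha hmin
  have hex : ∃ m, m % 2 = s % 2 ∧ IsParityMin x m := by
    refine ⟨a, ha.2, fun p hp => ?_⟩
    rw [← tail_mod hx2 p]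
    exact hmin _ ⟨Nat.mod_lt _ (by omega), by rw [Nat.mod_mul_right_mod]; omega⟩
  refine ⟨Nat.find hex, ?_, (Nat.find_spec hex).1, (Nat.find_spec hex).2,
    fun m' h1 h2 => Nat.find_min' hex ⟨h1, h2⟩⟩
  have hpar := (Nat.find_spec hex).1
  by_contra hlt
  push Not at hlt
  -- A first minimal start beyond `2 * n` could be moved back by one even period.
  refine Nat.find_min hex (m := Nat.find hex - 2 * n) (by omega) ⟨by omega, fun p hp => ?_⟩
  have hmod : tail x (Nat.find hex - 2 * n) = tail x (Nat.find hex) := by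
    rw [← tail_mod hx2 (Nat.find hex), ← tail_mod hx2 (Nat.find hex - 2 * n),
      ← Nat.mod_eq_sub_mod hlt]
  rw [hmod]
  exact (Nat.find_spec hex).2 p (by omega)

/-! ### Discarding starts in the search -/

namespace IsFirstMin

variable {x : ℕ → α} {s m i j k e : ℕ}

/-- If the start `i` beats the start `j`, then starts close behind `j` are not minimal. -/
theorem skip_right (h : IsFirstMin x s m) (hj : j % 2 = s % 2) (hinv : m = i ∨ j ≤ m)
    (hlt : AltLTAt (tail x i) (tail x j) k) (hi : i % 2 = s % 2) (he : e ≤ k + 2)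
    (he2 : e % 2 = 0) :
    m = i ∨ j + e ≤ m := by
  rcases hinv with hinv | hinv
  · exact .inl hinv
  -- If `m = j + d` with `d < e`, then `d` and `e` being even gives `d ≤ e - 2 ≤ k`, so `i + d`
  -- beats `m`.
  refine .inr (not_lt.mp fun hm => ?_)
  obtain ⟨d, rfl⟩ := Nat.exists_eq_add_of_le hinv
  have hp := h.parity
  exact h.isMin (i + d) (by omega) (hlt.tail_add (Nat.even_iff.mpr (by omega)) (by omega))

/-- If the start `j` beats the start `i`, then starts close behind `i` are not minimal. -/
theorem skip_left (h : IsFirstMin x s m) (hj : j % 2 = s % 2) (hinv : m = i ∨ j ≤ m)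
    (hij : i ≤ j) (hlt : AltLTAt (tail x j) (tail x i) k) (hi : i % 2 = s % 2)
    (he : e ≤ k + 2)
    (he2 : e % 2 = 0) : i + e ≤ m ∧ j ≤ m := by
  have hp := h.parity
  -- Otherwise `j + d` beats `m`. The instance `d = 0` rules out `m = i` and leaves `j ≤ m`; the
  -- instance `d = m - i`, with parity, gives the skip by `e`.
  have key : ∀ d, m = i + d → k < d := fun d hd => by
    by_contra hdk
    refine h.isMin (j + d) (by omega) ?_
    rw [hd]
    exact hlt.tail_add (Nat.even_iff.mpr (by omega)) (by omega)
  have h0 := key (m - i)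
  have h1 := key 0
  omega

/-- If `m = j + d`, then `i + d` has the same tail, hence is an earlier minimal start. This is where
taking the first minimal start matters. -/
theorem eq_of_tail_eq (h : IsFirstMin x s m) (hinv : m = i ∨ j ≤ m) (hij : i < j)
    (hj : j % 2 = s % 2) (hi : i % 2 = s % 2) (heq : tail x i = tail x j) : m = i := by
  rcases hinv with hinv | hinv
  · exact hinv
  obtain ⟨d, rfl⟩ := Nat.exists_eq_add_of_le hinv
  have hp := h.parity
  have : tail x (i + d) = tail x (j + d) := by
    funext t
    simpa [tail, add_assoc] using congrFun heq (d + t)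
  have := h.first (i + d) (by omega) (fun p hp' => by
    rw [this]; exact h.isMin p (by omega))
  omega

end IsFirstMin

end AlternatingOrder

/-! ### Rotations of primitive words -/

section Rotations

variable {α : Type*}

theorem omegaPow_periodic (T : List α) (hT : T ≠ []) :
    Function.Periodic (omegaPow T hT) T.length := fun t => by simp [omegaPow]

theorem omegaPow_rotate (T : List α) (hT : T ≠ []) (p : ℕ) (hT' : T.rotate p ≠ []) :
    omegaPow (T.rotate p) hT' = tail (omegaPow T hT) p := by
  funext t
  simp [omegaPow, tail, List.getElem_rotate, add_comm]

theorem altLT_iff_seqAltLT [LinearOrder α] {S T : List α} (hS : S ≠ []) (hT : T ≠ []) :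
    AltLT S T ↔ SeqAltLT (omegaPow S hS) (omegaPow T hT) := by
  simp [AltLT, SeqAltLT, AltLTAt, hS, hT]

theorem IsPrimitive.ne_nil {T : List α} (h : IsPrimitive T) : T ≠ [] := by
  rintro rfl
  have := (h [] 2 (by omega) (by simp)).2
  omega

theorem eq_flatten_replicate_take {T : List α} (hT : T ≠ []) {g : ℕ} (hg : g ∣ T.length)
    (hx : Function.Periodic (omegaPow T hT) g) :
    T = (List.replicate (T.length / g) (T.take g)).flatten := by
  have hn := List.length_pos_iff.mpr hT
  have hg0 : 0 < g := Nat.pos_of_dvd_of_pos hg hn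
  have key : ∀ c, c * g ≤ T.length → T.take (c * g) = (List.replicate c (T.take g)).flatten := by
    intro c
    induction c with
    | zero => simp
    | succ c ih =>
      intro hc
      rw [add_one_mul] at hc ⊢
      rw [List.replicate_succ', List.flatten_append, ← ih (by omega), List.take_add]
      congr 1
      simp only [List.flatten_cons, List.flatten_nil, List.append_nil]
      apply List.ext_getElem
      · simp; omega
      · intro t h1 h2
        simp only [List.length_take, List.length_drop] at h1 h2
        have := hx.nat_mul c t
        simp only [omegaPow, Nat.cast_id, Nat.mod_eq_of_lt (show t + c * g < T.length by omega),
          Nat.mod_eq_of_lt (show t < T.length by omega)] at this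
        simp [← this, add_comm]
  have := key (T.length / g) (by rw [Nat.div_mul_cancel hg])
  rwa [Nat.div_mul_cancel hg, List.take_length] at this

/-- Equal tails at distance `d` make `d` a period of the whole word, hence also `gcd d |T|`. If that
were smaller than `|T|`, then `T` would be a proper power. -/
theorem IsPrimitive.eq_mod_of_tail_eq {T : List α} (h : IsPrimitive T) {p d : ℕ}
    (heq : tail (omegaPow T h.ne_nil) p = tail (omegaPow T h.ne_nil) (p + d)) :
    T.length ∣ d := by
  set x := omegaPow T h.ne_nil with hxdef
  have hn := List.length_pos_iff.mpr h.ne_nil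
  have hx : Function.Periodic x T.length := omegaPow_periodic T h.ne_nil
  have hd : Function.Periodic x d := fun t => by
    -- Shifting by `p` full periods moves any position `t` past `p`, where the hypothesis applies.
    have hle : p ≤ p * T.length := Nat.le_mul_of_pos_right p hn
    have h1 := congrFun heq (t + p * T.length - p)
    have h2 := hx.nat_mul p t
    have h3 := hx.nat_mul p (t + d)
    simp only [tail, Nat.cast_id] at h1 h2 h3
    rw [← h2, ← h3, show t + p * T.length = p + (t + p * T.length - p) by omega, h1]
    congr 1
    omega
  by_contra hnd
  have hlt : d.gcd T.length < T.length :=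
    lt_of_le_of_ne (Nat.gcd_le_right _ hn) fun hg => hnd (hg ▸ Nat.gcd_dvd_left _ _)
  -- Bézout: some multiple of `d` is congruent to the gcd modulo `|T|`.
  obtain ⟨c, hc⟩ := Nat.exists_mul_mod_eq_gcd hlt
  have hg : Function.Periodic x (d.gcd T.length) := fun t => by
    have h1 := hd.nat_mul c t
    have h2 := hx.nat_mul (d * c / T.length) (t + d * c % T.length)
    simp only [Nat.cast_id] at h1 h2
    rw [← hc.2, ← h2, ← h1, add_assoc, Nat.mod_add_div', mul_comm]
  have := (h _ _ (Nat.div_pos hlt.le (Nat.gcd_pos_of_pos_right _ hn))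
    (eq_flatten_replicate_take h.ne_nil (Nat.gcd_dvd_right _ _) hg)).2
  have h3 := Nat.div_mul_cancel (Nat.gcd_dvd_right d T.length)
  rw [this] at h3
  omega

variable [LinearOrder α]

/-- Totality turns minimality into strict precedence once equality is excluded, and an equal tail
would make `|T|` divide `|U|`, although `0 < |U| < |T|`. -/
theorem IsPrimitive.isGalois_rotate {T : List α} (h : IsPrimitive T) {w : ℕ}
    (hw : ∀ p, ¬ SeqAltLT (tail (omegaPow T h.ne_nil) p) (tail (omegaPow T h.ne_nil) w)) :
    IsGalois (T.rotate w) := by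
  have hne : ∀ p, T.rotate p ≠ [] := fun p => by simpa using h.ne_nil
  refine ⟨hne w, fun U V hU hV hUV => ?_⟩
  have hVU : V ++ U = T.rotate (w + U.length) := by
    rw [← List.rotate_rotate, hUV, List.rotate_append_length_eq]
  have hlen : T.length = U.length + V.length := by
    simpa using congrArg List.length hUV
  have hU' := List.length_pos_iff.mpr hU
  have hV' := List.length_pos_iff.mpr hV
  rw [hVU, altLT_iff_seqAltLT (hne _) (hne _), omegaPow_rotate T h.ne_nil,
    omegaPow_rotate T h.ne_nil]
  refine (seqAltLT_or_seqAltLT fun heq => ?_).resolve_right (hw _)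
  have := Nat.le_of_dvd hU' (h.eq_mod_of_tail_eq heq)
  omega

theorem IsGalois.altLT_of_isRotated {W W' : List α} (h : IsGalois W) (hr : W ~r W')
    (hne : W' ≠ W) : AltLT W W' := by
  obtain ⟨r, hr', rfl⟩ := List.isRotated_iff_mod.mp hr
  have hr0 : r ≠ 0 := by rintro rfl; simp at hne
  have hrl : r ≠ W.length := by rintro rfl; simp at hne
  rw [List.rotate_eq_drop_append_take hr']
  refine h.2 _ _ ?_ ?_ (List.take_append_drop r W).symm
  · simp [hr0, h.1]
  · simp; omega

theorem IsGalois.eq_of_isRotated {W W' : List α} (h : IsGalois W) (h' : IsGalois W')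
    (hr : W ~r W') : W' = W := by
  by_contra hne
  have h1 := h.altLT_of_isRotated hr hne
  have h2 := h'.altLT_of_isRotated hr.symm (Ne.symm hne)
  rw [altLT_iff_seqAltLT h.1 h'.1] at h1
  rw [altLT_iff_seqAltLT h'.1 h.1] at h2
  exact h1.asymm h2

end Rotations

/-! ### Reasoning about bounded executions -/

section Execution

variable {α : Type*} [LinearOrder α]

/-- From the given configuration, the program `P` gets to one that satisfies `Q` in at most `t`
steps, and all registers are at most `B` on the way. -/
inductive Reach (P : Program) (T : List α) (B : ℕ) (Q : Config P α → Prop) :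
    ℕ → Config P α → Prop
  | refl (t : ℕ) (c : Config P α) (hc : ∀ r, c.reg r ≤ B) (hQ : Q c) : Reach P T B Q t c
  | step {t : ℕ} {c c' : Config P α} (hc : ∀ r, c.reg r ≤ B) (hs : P.step T c = some c')
      (h : Reach P T B Q t c') : Reach P T B Q (t + 1) c

namespace Reach

variable {P : Program} {T : List α} {B t : ℕ} {Q : Config P α → Prop} {c : Config P α}
  {l : P.Label} {reg reg' : P.Reg → ℕ} {out out' : List α}

theorem mono {t' : ℕ} (h : Reach P T B Q t c) (ht : t ≤ t') : Reach P T B Q t' c := by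
  induction h generalizing t' with
  | refl _ c hc hQ => exact .refl _ _ hc hQ
  | step hc hs _ ih =>
    obtain ⟨t', rfl⟩ := Nat.exists_eq_add_of_le' (Nat.le_of_add_left_le ht)
    exact .step hc hs (ih (by omega))

/-- `Reach` looks forward from a configuration while `run` counts from the initial one; the executed
prefix of length `t₀`, with its register bound, is what the induction carries along. -/
theorem exists_run {t₀ : ℕ} (h : Reach P T B Q t c) (hc : P.run T t₀ = some c)
    (hB : ∀ s < t₀, ∀ c, P.run T s = some c → ∀ r, c.reg r ≤ B) :
    ∃ t' ≤ t₀ + t, ∃ d, P.run T t' = some d ∧ Q d ∧ P.RegsBounded T t' B := by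
  have hstep : ∀ {t₀ c}, P.run T t₀ = some c → (∀ r, c.reg r ≤ B) →
      (∀ s < t₀, ∀ c, P.run T s = some c → ∀ r, c.reg r ≤ B) → P.RegsBounded T t₀ B := by
    intro t₀ c hc hb hB s hs d hd
    rcases hs.lt_or_eq with hs | rfl
    · exact hB s hs d hd
    · rw [hc] at hd
      cases hd
      exact hb
  induction h generalizing t₀ with
  | refl t c hb hQ => exact ⟨t₀, by omega, c, hc, hQ, hstep hc hb hB⟩
  | @step t c c' hb hs h ih =>
    have hc' : P.run T (t₀ + 1) = some c' := by simp [Program.run, hc, hs]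
    obtain ⟨t', ht', h'⟩ := ih hc' fun s hs => hstep hc hb hB s (by omega)
    exact ⟨t', by omega, h'⟩

/-- This and the following rules are applied backwards. The new registers enter through the equation
`hu`, so that each update can be rewritten to a normal form. -/
theorem const {d : P.Reg} {v : ℕ} {l' : P.Label} (hl : P.code l = .const d v l')
    (hb : ∀ r, reg r ≤ B) (hu : Function.update reg d v = reg')
    (h : Reach P T B Q t ⟨l', reg', out⟩) :
    Reach P T B Q (t + 1) ⟨l, reg, out⟩ :=
  .step hb (by simp [Program.step, hl, hu]) h

theorem add {d a b : P.Reg} {l' : P.Label} (hl : P.code l = .add d a b l')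
    (hb : ∀ r, reg r ≤ B) (hu : Function.update reg d (reg a + reg b) = reg')
    (h : Reach P T B Q t ⟨l', reg', out⟩) :
    Reach P T B Q (t + 1) ⟨l, reg, out⟩ :=
  .step hb (by simp [Program.step, hl, hu]) h

theorem sub {d a b : P.Reg} {l' : P.Label} (hl : P.code l = .sub d a b l')
    (hb : ∀ r, reg r ≤ B) (hu : Function.update reg d (reg a - reg b) = reg')
    (h : Reach P T B Q t ⟨l', reg', out⟩) :
    Reach P T B Q (t + 1) ⟨l, reg, out⟩ :=
  .step hb (by simp [Program.step, hl, hu]) h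

theorem cmpReg_lt {a b : P.Reg} {l₁ l₂ l₃ : P.Label} (hl : P.code l = .cmpReg a b l₁ l₂ l₃)
    (hb : ∀ r, reg r ≤ B) (hab : reg a < reg b) (h : Reach P T B Q t ⟨l₁, reg, out⟩) :
    Reach P T B Q (t + 1) ⟨l, reg, out⟩ :=
  .step hb (by simp [Program.step, hl, compare_lt_iff_lt.mpr hab, Program.select]) h

theorem cmpReg_ge {a b : P.Reg} {l₁ l₂ : P.Label} (hl : P.code l = .cmpReg a b l₁ l₂ l₂)
    (hb : ∀ r, reg r ≤ B) (hab : reg b ≤ reg a) (h : Reach P T B Q t ⟨l₂, reg, out⟩) :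
    Reach P T B Q (t + 1) ⟨l, reg, out⟩ := by
  refine .step hb ?_ h
  rcases hab.lt_or_eq with hab | hab
  · simp [Program.step, hl, compare_gt_iff_gt.mpr hab, Program.select]
  · simp [Program.step, hl, compare_eq_iff_eq.mpr hab.symm, Program.select]

theorem cmpSym {a b : P.Reg} {l₁ l₂ l₃ : P.Label} {x y : α}
    (hl : P.code l = .cmpSym a b l₁ l₂ l₃) (hb : ∀ r, reg r ≤ B) (hx : T[reg a]? = some x)
    (hy : T[reg b]? = some y)
    (h : Reach P T B Q t ⟨Program.select (compare x y) l₁ l₂ l₃, reg, out⟩) :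
    Reach P T B Q (t + 1) ⟨l, reg, out⟩ :=
  .step hb (by simp [Program.step, hl, hx, hy]) h

theorem emit {a : P.Reg} {l' : P.Label} {x : α} (hl : P.code l = .emit a l')
    (hb : ∀ r, reg r ≤ B) (hx : T[reg a]? = some x)
    (ho : out ++ [x] = out') (h : Reach P T B Q t ⟨l', reg, out'⟩) :
    Reach P T B Q (t + 1) ⟨l, reg, out⟩ :=
  .step hb (by simp [Program.step, hl, hx, ho]) h

end Reach

end Execution

/-! ### The program

The starts of either parity are searched for a minimal one, with a candidate `i` and a challenger
`j`, of which `k` symbols have been compared. The two winners are then compared with each other. -/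

/-- The registers: the length of the input, the candidate `i`, the challenger `j`, the number `k` of
symbols on which they agree, the reduced positions `a` and `b` of the symbols compared, the winner
of the first search, and registers that hold constants. -/
inductive GReg
  | len | i | j | k | a | b | first | one | two | dbl | zero
  deriving DecidableEq

instance : Fintype GReg where
  elems := {.len, .i, .j, .k, .a, .b, .first, .one, .two, .dbl, .zero}
  complete r := by cases r <;> decide

/-- The labels. The phase `some s` is the search among the starts of one parity, the phase `none` is
the comparison of the two winners. A further argument is the parity of `k`. -/
inductive GLabel
  | start | setTwo | setDbl | setJ
  | reset (f : Option Bool) | check (f : Option Bool)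
  | addA (f : Option Bool) (p : Bool) | addB (f : Option Bool) (p : Bool)
  | redA (f : Option Bool) (p : Bool) | subA (f : Option Bool) (p : Bool)
  | redB (f : Option Bool) (p : Bool) | subB (f : Option Bool) (p : Bool)
  | sym (f : Option Bool) (p : Bool) | inc (f : Option Bool) (p : Bool)
  | tst (f : Option Bool) (p : Bool)
  | left (f : Option Bool) (p : Bool) | right (f : Option Bool) (p : Bool)
  | moveJ (s : Bool) | moveI (s : Bool) | cmpIJ (s : Bool) | copyJ (s : Bool) | nextJ (s : Bool)
  | done (f : Option Bool) | oddI | oddJ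
  | redI | subI | outA | outK | put | incA | wrap | wrapA | incK | more | fin
  deriving DecidableEq, Fintype

/-- The code of the program. -/
def galoisCode : GLabel → Instr GLabel GReg
  | .start => .const .one 1 .setTwo
  | .setTwo => .const .two 2 .setDbl
  | .setDbl => .add .dbl .len .len .setJ
  -- The candidate `i` keeps its initial value `0`; the next even start is `2`.
  | .setJ => .const .j 2 (.reset (some false))
  | .reset f => .const .k 0 (.check f)
  | .check (some s) => .cmpReg .j .dbl (.addA (some s) false) (.done (some s)) (.done (some s))
  | .check none => .const .k 0 (.addA none false)
  | .addA f p => .add .a .i .k (.addB f p)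
  | .addB f p => .add .b .j .k (.redA f p)
  | .redA f p => .cmpReg .a .len (.redB f p) (.subA f p) (.subA f p)
  | .subA f p => .sub .a .a .len (.redA f p)
  | .redB f p => .cmpReg .b .len (.sym f p) (.subB f p) (.subB f p)
  | .subB f p => .sub .b .b .len (.redB f p)
  | .sym f false => .cmpSym .a .b (.left f false) (.inc f false) (.right f false)
  -- At an odd mismatch the larger symbol wins.
  | .sym f true => .cmpSym .a .b (.right f true) (.inc f true) (.left f true)
  | .inc f p => .add .k .k .one (.tst f p)
  | .tst f p => .cmpReg .k .len (.addA f (!p)) (.done f) (.done f)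
  -- The skip is the least even number exceeding `k`: `k + 2` for even `k`, `k + 1` for odd `k`.
  | .left (some s) false => .add .k .k .two (.moveJ s)
  | .left (some s) true => .add .k .k .one (.moveJ s)
  | .left none _ => .const .k 0 .redI
  | .moveJ s => .add .j .j .k (.reset (some s))
  | .right (some s) false => .add .k .k .two (.moveI s)
  | .right (some s) true => .add .k .k .one (.moveI s)
  | .right none _ => .add .i .j .zero .redI
  | .moveI s => .add .i .i .k (.cmpIJ s)
  | .cmpIJ s => .cmpReg .i .j (.copyJ s) (.nextJ s) (.nextJ s)
  | .copyJ s => .add .i .j .zero (.nextJ s)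
  | .nextJ s => .add .j .i .two (.reset (some s))
  | .done (some false) => .add .first .i .zero .oddI
  | .oddI => .const .i 1 .oddJ
  | .oddJ => .const .j 3 (.reset (some true))
  | .done (some true) => .add .j .first .zero (.reset none)
  | .done none => .const .k 0 .redI
  | .redI => .cmpReg .i .len .outA .subI .subI
  | .subI => .sub .i .i .len .redI
  | .outA => .add .a .i .zero .outK
  | .outK => .const .k 0 .put
  | .put => .emit .a .incA
  | .incA => .add .a .a .one .wrap
  | .wrap => .cmpReg .a .len .incK .wrapA .wrapA
  | .wrapA => .const .a 0 .incK
  | .incK => .add .k .k .one .more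
  | .more => .cmpReg .k .len .put .fin .fin
  | .fin => .halt

/-- The program that computes the Galois rotation of its input. -/
def galoisProgram : Program where
  Label := GLabel
  Reg := GReg
  code := galoisCode
  start := .start
  lenReg := .len
  posReg := .i

/-- The contents of the registers after the constants have been set. -/
def regs (n i j k a b q : ℕ) : GReg → ℕ
  | .len => n
  | .i => i
  | .j => j
  | .k => k
  | .a => a
  | .b => b
  | .first => q
  | .one => 1
  | .two => 2
  | .dbl => n + n
  | .zero => 0

section Registers

variable {n i j k a b q B v : ℕ}

theorem regs_le (h : 2 ≤ B ∧ n + n ≤ B ∧ i ≤ B ∧ j ≤ B ∧ k ≤ B ∧ a ≤ B ∧ b ≤ B ∧ q ≤ B)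
    (r : GReg) : regs n i j k a b q r ≤ B := by
  cases r <;> simp only [regs] <;> omega

theorem update_regs_i :
    Function.update (regs n i j k a b q) .i v = regs n v j k a b q := by
  funext r; cases r <;> rfl

theorem update_regs_j :
    Function.update (regs n i j k a b q) .j v = regs n i v k a b q := by
  funext r; cases r <;> rfl

theorem update_regs_k :
    Function.update (regs n i j k a b q) .k v = regs n i j v a b q := by
  funext r; cases r <;> rfl

theorem update_regs_a :
    Function.update (regs n i j k a b q) .a v = regs n i j k v b q := by
  funext r; cases r <;> rfl

theorem update_regs_b :
    Function.update (regs n i j k a b q) .b v = regs n i j k a v q := by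
  funext r; cases r <;> rfl

theorem update_regs_first :
    Function.update (regs n i j k a b q) .first v = regs n i j k a b v := by
  funext r; cases r <;> rfl

end Registers

/-- The configuration of the program with the given label, registers and output. -/
abbrev cfg {α : Type*} (l : GLabel) (r : GReg → ℕ) (out : List α) : Config galoisProgram α :=
  ⟨l, r, out⟩

/-! ### Correctness and running time of the program -/

section Verification

variable {α : Type*} {T : List α} {i j k a b q t : ℕ} {f : Option Bool}
  {p s : Bool} {out : List α} {Q : Config galoisProgram α → Prop}

theorem getElem?_eq_omegaPow (hT : T ≠ []) (ha : a < T.length) :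
    T[a]? = some (omegaPow T hT a) := by
  simp [omegaPow, Nat.mod_eq_of_lt ha, ha]

/-- The input is not empty, and the numbers in the registers are not too large. -/
def Small (T : List α) (i j k a b q : ℕ) : Prop :=
  0 < T.length ∧ i ≤ 8 * T.length ∧ j ≤ 8 * T.length ∧ k ≤ 8 * T.length ∧ a ≤ 8 * T.length ∧
    b ≤ 8 * T.length ∧ q ≤ 8 * T.length

theorem Small.regs_le (h : Small T i j k a b q) (r : GReg) :
    regs T.length i j k a b q r ≤ 10 * T.length := by
  unfold Small at h
  exact GaloisWord.regs_le (by omega) r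

variable [LinearOrder α]

/-- Reachability for the program, with the register bound that is used throughout. -/
abbrev GReach (T : List α) (t : ℕ) (c : Config galoisProgram α)
    (Q : Config galoisProgram α → Prop) : Prop :=
  Reach galoisProgram T (10 * T.length) Q t c

/-- Remainders are computed by repeated subtraction. At most `c` subtractions of two steps each and
a final test are needed; `c = 2` suffices for symbol positions, which are below `3 * |T|`. -/
theorem reach_redA (h : Small T i j k a b q) (c : ℕ) (hc : a < (c + 1) * T.length)
    (hd : GReach T t (cfg (.redB f p) (regs T.length i j k (a % T.length) b q) out) Q) :
    GReach T (t + (2 * c + 1)) (cfg (.redA f p) (regs T.length i j k a b q) out) Q := by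
  induction c generalizing a with
  | zero =>
    rw [Nat.mod_eq_of_lt (by omega)] at hd
    exact .cmpReg_lt rfl h.regs_le (show a < T.length by omega) hd
  | succ c ih =>
    rcases lt_or_ge a T.length with ha | ha
    · exact (ih h (by nlinarith) hd).mono (by omega)
    · refine Reach.cmpReg_ge (t := t + (2 * c + 1) + 1) rfl h.regs_le ha ?_
      refine Reach.sub rfl h.regs_le (update_regs_a (v := a - T.length)) ?_
      rw [Nat.mod_eq_sub_mod ha] at hd
      exact ih (by unfold Small at *; omega) (by rw [add_one_mul] at hc; omega) hd

theorem reach_redB (h : Small T i j k a b q) (c : ℕ) (hc : b < (c + 1) * T.length)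
    (hd : GReach T t (cfg (.sym f p) (regs T.length i j k a (b % T.length) q) out) Q) :
    GReach T (t + (2 * c + 1)) (cfg (.redB f p) (regs T.length i j k a b q) out) Q := by
  induction c generalizing b with
  | zero =>
    rw [Nat.mod_eq_of_lt (by omega)] at hd
    exact .cmpReg_lt rfl h.regs_le (show b < T.length by omega) hd
  | succ c ih =>
    rcases lt_or_ge b T.length with ha | ha
    · exact (ih h (by nlinarith) hd).mono (by omega)
    · refine Reach.cmpReg_ge (t := t + (2 * c + 1) + 1) rfl h.regs_le ha ?_
      refine Reach.sub rfl h.regs_le (update_regs_b (v := b - T.length)) ?_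
      rw [Nat.mod_eq_sub_mod ha] at hd
      exact ih (by unfold Small at *; omega) (by rw [add_one_mul] at hc; omega) hd

theorem reach_redI (h : Small T i j k a b q) (c : ℕ) (hc : i < (c + 1) * T.length)
    (hd : GReach T t (cfg .outA (regs T.length (i % T.length) j k a b q) out) Q) :
    GReach T (t + (2 * c + 1)) (cfg .redI (regs T.length i j k a b q) out) Q := by
  induction c generalizing i with
  | zero =>
    rw [Nat.mod_eq_of_lt (by omega)] at hd
    exact .cmpReg_lt rfl h.regs_le (show i < T.length by omega) hd
  | succ c ih =>
    rcases lt_or_ge i T.length with ha | ha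
    · exact (ih h (by nlinarith) hd).mono (by omega)
    · refine Reach.cmpReg_ge (t := t + (2 * c + 1) + 1) rfl h.regs_le ha ?_
      refine Reach.sub rfl h.regs_le (update_regs_i (v := i - T.length)) ?_
      rw [Nat.mod_eq_sub_mod ha] at hd
      exact ih (by unfold Small at *; omega) (by rw [add_one_mul] at hc; omega) hd

/-- Comparing one symbol of the candidate with one of the challenger. -/
theorem reach_sym (hT : T ≠ []) (h : Small T i j k a b q) (hi : i < 2 * T.length)
    (hj : j < 2 * T.length) (hk : k < T.length)
    (hd : GReach T t (cfg
        (Program.select (compare (omegaPow T hT (i + k)) (omegaPow T hT (j + k)))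
          (bif p then .right f p else .left f p) (.inc f p)
          (bif p then .left f p else .right f p))
        (regs T.length i j k ((i + k) % T.length) ((j + k) % T.length) q) out) Q) :
    GReach T (t + 13) (cfg (.addA f p) (regs T.length i j k a b q) out) Q := by
  have hn : 0 < T.length := h.1
  have h1 := Nat.mod_lt (i + k) hn
  have h2 := Nat.mod_lt (j + k) hn
  have hx : T[(i + k) % T.length]? = some (omegaPow T hT (i + k)) := by
    simp [getElem?_eq_omegaPow hT h1, omegaPow]
  have hy : T[(j + k) % T.length]? = some (omegaPow T hT (j + k)) := by
    simp [getElem?_eq_omegaPow hT h2, omegaPow]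
  refine Reach.add (t := t + 12) rfl h.regs_le (update_regs_a (v := i + k)) ?_
  refine Reach.add (t := t + 11) rfl
    (Small.regs_le (by unfold Small at *; omega)) (update_regs_b (v := j + k)) ?_
  refine reach_redA (t := t + 6) (by unfold Small at *; omega) 2 (by omega) ?_
  refine reach_redB (t := t + 1) (by unfold Small at *; omega) 2 (by omega) ?_
  have hb : ∀ r, regs T.length i j k ((i + k) % T.length) ((j + k) % T.length) q r
    ≤ 10 * T.length := Small.regs_le (by unfold Small at *; omega)
  cases p
  · exact Reach.cmpSym rfl hb hx hy hd
  · exact Reach.cmpSym rfl hb hx hy hd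

/-- One round of the comparison of the candidate and the challenger. -/
theorem reach_round (hT : T ≠ []) (h : Small T i j k a b q) (hi : i < 2 * T.length)
    (hj : j < 2 * T.length) (hk : k < T.length) (hp : k % 2 = p.toNat)
    (heq : ∀ t < k, omegaPow T hT (i + t) = omegaPow T hT (j + t))
    (hinc : omegaPow T hT (i + k) = omegaPow T hT (j + k) → ∀ a b, Small T i j k a b q →
      GReach T t (cfg (.inc f p) (regs T.length i j k a b q) out) Q)
    (hleft : AltLTAt (tail (omegaPow T hT) i) (tail (omegaPow T hT) j) k →
      ∀ a b, Small T i j k a b q →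
      GReach T t (cfg (.left f p) (regs T.length i j k a b q) out) Q)
    (hright : AltLTAt (tail (omegaPow T hT) j) (tail (omegaPow T hT) i) k →
      ∀ a b, Small T i j k a b q →
      GReach T t (cfg (.right f p) (regs T.length i j k a b q) out) Q) :
    GReach T (t + 13) (cfg (.addA f p) (regs T.length i j k a b q) out) Q := by
  have hn : 0 < T.length := h.1
  have h1 := Nat.mod_lt (i + k) hn
  have h2 := Nat.mod_lt (j + k) hn
  have heq' : ∀ t < k, tail (omegaPow T hT) j t = tail (omegaPow T hT) i t :=
    fun t ht => (heq t ht).symm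
  have hs : Small T i j k ((i + k) % T.length) ((j + k) % T.length) q := by
    unfold Small at *; omega
  refine reach_sym hT h hi hj hk ?_
  rcases lt_trichotomy (omegaPow T hT (i + k)) (omegaPow T hT (j + k)) with hlt | hlt | hlt
  · rw [compare_lt_iff_lt.mpr hlt]
    cases p
    · exact hleft ⟨heq, .inl ⟨Nat.even_iff.mpr hp, hlt⟩⟩ _ _ hs
    · exact hright ⟨heq', .inr ⟨Nat.odd_iff.mpr hp, hlt⟩⟩ _ _ hs
  · rw [compare_eq_iff_eq.mpr hlt]
    exact hinc hlt _ _ hs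
  · rw [compare_gt_iff_gt.mpr hlt]
    cases p
    · exact hright ⟨heq', .inl ⟨Nat.even_iff.mpr hp, hlt⟩⟩ _ _ hs
    · exact hleft ⟨heq, .inr ⟨Nat.odd_iff.mpr hp, hlt⟩⟩ _ _ hs

/-- After a symbol on which candidate and challenger agree, the comparison goes on, or it stops
since they are equal. -/
theorem reach_inc (h : Small T i j k a b q) (hk : k < T.length)
    (hlt : k + 1 < T.length →
      GReach T t (cfg (.addA f (!p)) (regs T.length i j (k + 1) a b q) out) Q)
    (hge : k + 1 = T.length → GReach T t (cfg (.done f) (regs T.length i j (k + 1) a b q) out) Q) :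
    GReach T (t + 2) (cfg (.inc f p) (regs T.length i j k a b q) out) Q := by
  refine Reach.add (t := t + 1) rfl h.regs_le (update_regs_k (v := k + 1)) ?_
  have hb : ∀ r, regs T.length i j (k + 1) a b q r ≤ 10 * T.length :=
    Small.regs_le (by unfold Small at *; omega)
  rcases lt_or_ge (k + 1) T.length with hk' | hk'
  · exact .cmpReg_lt rfl hb hk' (hlt hk')
  · exact .cmpReg_ge rfl hb hk' (hge (by omega))

theorem reach_reset (h : Small T i j k a b q)
    (hlt : j < 2 * T.length →
      GReach T t (cfg (.addA (some s) false) (regs T.length i j 0 a b q) out) Q)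
    (hge : 2 * T.length ≤ j →
      GReach T t (cfg (.done (some s)) (regs T.length i j 0 a b q) out) Q) :
    GReach T (t + 2) (cfg (.reset (some s)) (regs T.length i j k a b q) out) Q := by
  refine Reach.const (t := t + 1) rfl h.regs_le (update_regs_k (v := 0)) ?_
  have hb : ∀ r, regs T.length i j 0 a b q r ≤ 10 * T.length :=
    Small.regs_le (by unfold Small at *; omega)
  rcases lt_or_ge j (2 * T.length) with hj | hj
  · exact .cmpReg_lt rfl hb (show j < T.length + T.length by omega) (hlt hj)
  · exact .cmpReg_ge rfl hb (show T.length + T.length ≤ j by omega) (hge hj)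

/-- The quantified `e` hides the parity case: its bounds and evenness are all that the skipping
lemmas and the time bound need. -/
theorem reach_left (h : Small T i j (k + 2) a b q) (hp : k % 2 = p.toNat)
    (hd : ∀ e, e ≤ k + 2 → k + 1 ≤ e → e % 2 = 0 →
      GReach T t (cfg (.reset (some s)) (regs T.length i (j + e) e a b q) out) Q) :
    GReach T (t + 2) (cfg (.left (some s) p) (regs T.length i j k a b q) out) Q := by
  have hb : ∀ k', k' ≤ k + 2 → ∀ r, regs T.length i j k' a b q r ≤ 10 * T.length :=
    fun k' _ => Small.regs_le (by unfold Small at *; omega)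
  cases p
  · refine Reach.add (t := t + 1) rfl (hb k (by omega)) (update_regs_k (v := k + 2)) ?_
    refine Reach.add rfl (hb (k + 2) le_rfl) (update_regs_j (v := j + (k + 2))) ?_
    exact hd (k + 2) le_rfl (by omega) (by simp at hp; omega)
  · refine Reach.add (t := t + 1) rfl (hb k (by omega)) (update_regs_k (v := k + 1)) ?_
    refine Reach.add rfl (hb (k + 1) (by omega)) (update_regs_j (v := j + (k + 1))) ?_
    exact hd (k + 1) (by omega) le_rfl (by simp at hp; omega)

/-- After `j` has won, both the skip behind `i` and the old bound `j` are lower bounds for the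
minimal start, so the candidate becomes their maximum. -/
theorem reach_cmpIJ (h : Small T i j k a b q)
    (hd : GReach T t (cfg (.reset (some s)) (regs T.length (max i j) (max i j + 2) k a b q) out)
      Q) :
    GReach T (t + 3) (cfg (.cmpIJ s) (regs T.length i j k a b q) out) Q := by
  rcases lt_or_ge i j with hij | hij
  · refine Reach.cmpReg_lt (t := t + 2) rfl h.regs_le hij ?_
    refine Reach.add (t := t + 1) rfl h.regs_le (update_regs_i (v := j)) ?_
    refine Reach.add rfl (Small.regs_le (i := j) (by unfold Small at *; omega))
      (update_regs_j (v := j + 2)) ?_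
    rwa [max_eq_right hij.le] at hd
  · refine Reach.mono (t := t + 2) ?_ (by omega)
    refine Reach.cmpReg_ge (t := t + 1) rfl h.regs_le hij ?_
    refine Reach.add rfl h.regs_le (update_regs_j (v := i + 2)) ?_
    rwa [max_eq_left hij] at hd

theorem reach_right (h : Small T (i + (k + 2)) j (k + 2) a b q) (hp : k % 2 = p.toNat)
    (hd : ∀ e, e ≤ k + 2 → k + 1 ≤ e → e % 2 = 0 →
      GReach T t (cfg (.reset (some s))
        (regs T.length (max (i + e) j) (max (i + e) j + 2) e a b q) out) Q) :
    GReach T (t + 5) (cfg (.right (some s) p) (regs T.length i j k a b q) out) Q := by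
  have hb : ∀ k', k' ≤ k + 2 → ∀ r, regs T.length i j k' a b q r ≤ 10 * T.length :=
    fun k' _ => Small.regs_le (by unfold Small at *; omega)
  cases p
  · refine Reach.add (t := t + 4) rfl (hb k (by omega)) (update_regs_k (v := k + 2)) ?_
    refine Reach.add (t := t + 3) rfl (hb (k + 2) le_rfl) (update_regs_i (v := i + (k + 2))) ?_
    exact reach_cmpIJ h (hd (k + 2) le_rfl (by omega) (by simp at hp; omega))
  · refine Reach.add (t := t + 4) rfl (hb k (by omega)) (update_regs_k (v := k + 1)) ?_
    refine Reach.add (t := t + 3) rfl (hb (k + 1) (by omega)) (update_regs_i (v := i + (k + 1))) ?_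
    exact reach_cmpIJ (by unfold Small at *; omega)
      (hd (k + 1) (by omega) le_rfl (by simp at hp; omega))

/-- The search finds the first minimal start. -/
theorem reach_search (hT : T ≠ []) {m : ℕ} (hm : IsFirstMin (omegaPow T hT) s.toNat m)
    (hm2 : m < 2 * T.length)
    (hd : ∀ j k a b, Small T m j k a b q →
      GReach T t (cfg (.done (some s)) (regs T.length m j k a b q) out) Q)
    (M : ℕ) (h : Small T i j k a b q) (hi : i % 2 = s.toNat) (hj : j % 2 = s.toNat) (hij : i < j)
    (hj2 : j < 2 * T.length) (hinv : m = i ∨ j ≤ m) (hk : k < T.length) (hp : k % 2 = p.toNat)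
    (heq : ∀ t < k, omegaPow T hT (i + t) = omegaPow T hT (j + t))
    (hM : 5 * T.length ≤ i + j + k + M) :
    GReach T (t + 20 * M) (cfg (.addA (some s) p) (regs T.length i j k a b q) out) Q := by
  have hs2 : s.toNat % 2 = s.toNat := by cases s <;> rfl
  -- `M` bounds the remaining rounds: `i + j + k` grows in every round and stays below `2 * |T| + 2
  -- * |T| + |T|`. A round costs at most 13 steps to compare and 7 to update.
  induction M generalizing i j k a b p with
  | zero => omega
  | succ M ih =>
    have hmono : GReach T (t + 20 * M + 7 + 13)
      (cfg (.addA (some s) p) (regs T.length i j k a b q) out) Q := by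
      refine reach_round hT h (by omega) hj2 hk hp heq ?_ ?_ ?_
      · intro hsym a b h
        refine Reach.mono (t := t + 20 * M + 2) ?_ (by omega)
        have heq' : ∀ t < k + 1, omegaPow T hT (i + t) = omegaPow T hT (j + t) := by
          intro t ht
          rcases Nat.lt_succ_iff_lt_or_eq.mp ht with ht | rfl
          · exact heq t ht
          · exact hsym
        refine reach_inc h hk (fun hk' => ?_) (fun hk' => ?_)
        · refine ih (by unfold Small at *; omega) hi hj hij hj2 hinv hk' ?_ heq' (by omega)
          cases p <;> simp at hp ⊢ <;> omega
        · have : m = i := hm.eq_of_tail_eq hinv hij (by omega) (by omega)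
            (tail_eq_of_periodic (by omega) (omegaPow_periodic T hT) (hk' ▸ heq'))
          subst this
          exact (hd _ _ _ _ (by unfold Small at *; omega)).mono (by omega)
      · intro hlt a b h
        refine Reach.mono (t := t + 20 * M + 2 + 2) ?_ (by omega)
        refine reach_left (by unfold Small at *; omega) hp fun e he he' he2 => ?_
        have hinv' := hm.skip_right (by omega) hinv hlt (by omega) he he2
        refine reach_reset (by unfold Small at *; omega) (fun hj' => ?_) (fun hj' => ?_)
        · exact ih (by unfold Small at *; omega) hi (by omega) (by omega) hj' hinv' (by omega) rfl
            (by simp) (by omega)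
        -- The challenger has left the range below `2 * |T|` that contains `m`, so only `m = i`
        -- remains.
        · have : m = i := by omega
          subst this
          exact (hd _ _ _ _ (by unfold Small at *; omega)).mono (by omega)
      · intro hlt a b h
        refine Reach.mono (t := t + 20 * M + 2 + 5) ?_ (by omega)
        refine reach_right (by unfold Small at *; omega) hp fun e he he' he2 => ?_
        have hinv' := hm.skip_left (by omega) hinv hij.le hlt (by omega) he he2
        have hpar := hm.parity
        have hmax : max (i + e) j % 2 = s.toNat := by
          rcases max_choice (i + e) j with h | h <;> rw [h] <;> omega
        have hle : max (i + e) j ≤ m := max_le hinv'.1 hinv'.2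
        have hle1 := le_max_left (i + e) j
        have hle2 := le_max_right (i + e) j
        generalize max (i + e) j = i' at *
        refine reach_reset (by unfold Small at *; omega) (fun hj' => ?_) (fun hj' => ?_)
        · exact ih (by unfold Small at *; omega) hmax (by omega) (by omega) hj' (by omega)
            (by omega) rfl (by simp) (by omega)
        · have : m = i' := by omega
          subst this
          exact (hd _ _ _ _ (by unfold Small at *; omega)).mono (by omega)
    exact hmono.mono (by omega)

/-- The comparison of the two winners. -/
theorem reach_final (hT : T ≠ []) (hi : i < 2 * T.length) (hj : j < 2 * T.length)
    (hd : ∀ w j' k a b, Small T w j' k a b q → w < 2 * T.length →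
      (w = i ∧ ¬ SeqAltLT (tail (omegaPow T hT) j) (tail (omegaPow T hT) i) ∨
        w = j ∧ SeqAltLT (tail (omegaPow T hT) j) (tail (omegaPow T hT) i)) →
      GReach T t (cfg .redI (regs T.length w j' k a b q) out) Q)
    (M : ℕ) (h : Small T i j k a b q) (hk : k < T.length) (hp : k % 2 = p.toNat)
    (heq : ∀ t < k, omegaPow T hT (i + t) = omegaPow T hT (j + t)) (hM : T.length ≤ k + M) :
    GReach T (t + 16 * M) (cfg (.addA none p) (regs T.length i j k a b q) out) Q := by
  induction M generalizing k a b p with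
  | zero => omega
  | succ M ih =>
    have hmono : GReach T (t + 16 * M + 3 + 13)
      (cfg (.addA none p) (regs T.length i j k a b q) out) Q := by
      refine reach_round hT h hi hj hk hp heq ?_ ?_ ?_
      · intro hsym a b h
        have heq' : ∀ t < k + 1, omegaPow T hT (i + t) = omegaPow T hT (j + t) := by
          intro t ht
          rcases Nat.lt_succ_iff_lt_or_eq.mp ht with ht | rfl
          · exact heq t ht
          · exact hsym
        refine reach_inc (t := t + 16 * M + 1) h hk (fun hk' => ?_) (fun hk' => ?_)
        · refine (ih (by unfold Small at *; omega) hk' ?_ heq' (by omega)).mono (by omega)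
          cases p <;> simp at hp ⊢ <;> omega
        · refine Reach.const rfl (Small.regs_le (by unfold Small at *; omega))
            (update_regs_k (v := 0)) ?_
          -- A tie is possible, since for odd `|T|` both classes contain every rotation; either
          -- winner will do, and `i` is kept.
          refine (hd _ _ _ _ _ (by unfold Small at *; omega) hi (.inl ⟨rfl, ?_⟩)).mono (by omega)
          rw [← tail_eq_of_periodic (by omega) (omegaPow_periodic T hT) (hk' ▸ heq')]
          exact SeqAltLT.irrefl _
      · intro hlt a b h
        refine Reach.const (t := t + 16 * M + 2) rfl h.regs_le (update_regs_k (v := 0)) ?_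
        exact (hd _ _ _ _ _ (by unfold Small at *; omega) hi
          (.inl ⟨rfl, SeqAltLT.asymm ⟨k, hlt⟩⟩)).mono (by omega)
      · intro hlt a b h
        refine Reach.add (t := t + 16 * M + 2) rfl h.regs_le (update_regs_i (v := j)) ?_
        exact (hd _ _ _ _ _ (by unfold Small at *; omega) hj
          (.inr ⟨rfl, ⟨k, hlt⟩⟩)).mono (by omega)
    exact hmono.mono (by omega)

/-- The output loop. -/
theorem reach_put (hT : T ≠ [])
    (hd : ∀ a b k, Small T i j k a b q →
      GReach T t (cfg .fin (regs T.length i j k a b q) (T.rotate i)) Q)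
    (M : ℕ) (h : Small T i j k a b q) (hk : k < T.length) (ha : a = (i + k) % T.length)
    (hM : T.length = k + M) :
    GReach T (t + 6 * M) (cfg .put (regs T.length i j k a b q) ((T.rotate i).take k)) Q := by
  induction M generalizing k a with
  | zero => omega
  | succ M ih =>
    have hn : 0 < T.length := h.1
    have halt : a < T.length := ha ▸ Nat.mod_lt _ hn
    have hstep : (a + 1) % T.length = (i + (k + 1)) % T.length := by
      rw [ha, Nat.mod_add_mod, add_assoc]
    have htake : (T.rotate i).take k ++ [omegaPow T hT a] = (T.rotate i).take (k + 1) := by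
      rw [List.take_add_one, List.getElem?_rotate hk, ← add_comm i k, ← ha,
        getElem?_eq_omegaPow hT halt]
      rfl
    have key : GReach T (t + 6 * M + 2) (cfg .incK (regs T.length i j k ((a + 1) % T.length) b q)
        ((T.rotate i).take (k + 1))) Q := by
      have hlt := Nat.mod_lt (a + 1) hn
      refine Reach.add (t := t + 6 * M + 1) rfl
        (Small.regs_le (by unfold Small at *; omega)) (update_regs_k (v := k + 1)) ?_
      have hs : Small T i j (k + 1) ((a + 1) % T.length) b q := by unfold Small at *; omega
      rcases lt_or_ge (k + 1) T.length with hk' | hk'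
      · exact .cmpReg_lt rfl hs.regs_le hk' (ih hs hk' hstep (by omega))
      · refine .cmpReg_ge rfl hs.regs_le hk' ?_
        rw [List.take_of_length_le (by simpa using hk')]
        exact (hd _ _ _ hs).mono (by omega)
    refine Reach.emit (t := t + 6 * M + 5) rfl h.regs_le (getElem?_eq_omegaPow hT halt) htake ?_
    refine Reach.add (t := t + 6 * M + 4) rfl h.regs_le (update_regs_a (v := a + 1)) ?_
    have hs : Small T i j k (a + 1) b q := by unfold Small at *; omega
    rcases lt_or_ge (a + 1) T.length with hw | hw
    · rw [Nat.mod_eq_of_lt hw] at key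
      exact (Reach.cmpReg_lt (t := t + 6 * M + 2) rfl hs.regs_le hw key).mono (by omega)
    · rw [show a + 1 = T.length by omega, Nat.mod_self] at key
      refine Reach.cmpReg_ge (t := t + 6 * M + 3) rfl hs.regs_le hw ?_
      refine Reach.const rfl hs.regs_le (update_regs_a (v := 0)) ?_
      exact key

theorem reach_output (hT : T ≠ []) (h : Small T i j k a b q) (hi : i < 2 * T.length)
    (hd : ∀ a b k, Small T (i % T.length) j k a b q →
      GReach T t (cfg .fin (regs T.length (i % T.length) j k a b q) (T.rotate (i % T.length))) Q) :
    GReach T (t + 6 * T.length + 5) (cfg .redI (regs T.length i j k a b q) []) Q := by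
  have hlt := Nat.mod_lt i h.1
  have hs : ∀ k a, k ≤ 8 * T.length → a ≤ T.length → Small T (i % T.length) j k a b q := by
    intro k a hk ha
    unfold Small at *
    omega
  refine reach_redI (t := t + 6 * T.length + 2) h 1 (by omega) ?_
  refine Reach.add (t := t + 6 * T.length + 1) rfl
    (Small.regs_le (by unfold Small at *; omega)) (update_regs_a (v := i % T.length)) ?_
  refine Reach.const rfl (hs _ _ h.2.2.2.1 hlt.le).regs_le (update_regs_k (v := 0)) ?_
  exact reach_put hT hd _ (hs 0 _ (by omega) hlt.le) h.1 (by simp) (by omega)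

/-- The program halts with a start that is minimal among all starts, and with its rotation. -/
theorem reach_galoisRotation (hT : T ≠ []) :
    GReach T (300 * T.length) (galoisProgram.init T) fun d =>
      d.label = .fin ∧ ∃ w < T.length, d.reg .i = w ∧ d.out = T.rotate w ∧
        ∀ p, ¬ SeqAltLT (tail (omegaPow T hT) p) (tail (omegaPow T hT) w) := by
  have hn : 0 < T.length := List.length_pos_iff.mpr hT
  have hx := omegaPow_periodic T hT
  obtain ⟨m₀, hm₀, h₀⟩ := exists_isFirstMin hn hx 0
  obtain ⟨m₁, hm₁, h₁⟩ := exists_isFirstMin hn hx 1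
  have hp₀ := h₀.parity
  have hp₁ := h₁.parity
  -- The budget, from the end of the run backwards: output, final comparison, odd search, even
  -- search, initialization.
  refine Reach.mono (t := 0 + 6 * T.length + 5 + 16 * T.length + 3 + 20 * (5 * T.length) + 2 + 3
    + 20 * (5 * T.length) + 2 + 4) ?_ (by omega)
  refine Reach.const (t := _ + 3) rfl ?_ rfl ?_
  · intro r; cases r <;> simp [Function.update, galoisProgram] <;> omega
  refine Reach.const (t := _ + 2) rfl ?_ rfl ?_
  · intro r; cases r <;> simp [Function.update, galoisProgram] <;> omega
  refine Reach.add (t := _ + 1) (reg' := regs T.length 0 0 0 0 0 0) rfl ?_ ?_ ?_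
  · intro r; cases r <;> simp [Function.update, galoisProgram] <;> omega
  · funext r; cases r <;> rfl
  refine Reach.const rfl (Small.regs_le ?_) (update_regs_j (v := 2)) ?_
  · unfold Small; omega
  have hdone₁ : ∀ j k a b, Small T m₁ j k a b m₀ →
      GReach T (0 + 6 * T.length + 5 + 16 * T.length + 3)
        (cfg (.done (some true)) (regs T.length m₁ j k a b m₀) []) fun d =>
      d.label = .fin ∧ ∃ w < T.length, d.reg .i = w ∧ d.out = T.rotate w ∧
        ∀ p, ¬ SeqAltLT (tail (omegaPow T hT) p) (tail (omegaPow T hT) w) := by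
    intro j k a b h
    have hs : ∀ k, k ≤ 8 * T.length → Small T m₁ m₀ k a b m₀ := by
      intro k hk
      unfold Small at *
      omega
    refine Reach.add (t := _ + 2) rfl h.regs_le (update_regs_j (v := m₀)) ?_
    refine Reach.const (t := _ + 1) rfl (hs _ h.2.2.2.1).regs_le (update_regs_k (v := 0)) ?_
    refine Reach.const rfl (hs _ (by omega)).regs_le (update_regs_k (v := 0)) ?_
    refine reach_final hT hm₁ hm₀ (fun w j k a b h hw hmin => ?_) T.length (hs _ (by omega)) hn rfl
      (by simp) (by omega)
    refine reach_output hT h hw fun a b k h => ?_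
    refine .refl _ _ h.regs_le ⟨rfl, w % T.length, Nat.mod_lt _ hn, rfl, rfl, fun p hlt => ?_⟩
    rw [tail_mod hx] at hlt
    rcases Nat.mod_two_eq_zero_or_one p with hp | hp
    · have hp' := h₀.isMin p (by omega)
      rcases hmin with ⟨rfl, hmin⟩ | ⟨rfl, hmin⟩
      -- The odd winner was kept, so its tail equals or precedes that of the even winner; in both
      -- cases an even start beating it would beat `m₀`.
      · rcases eq_or_ne (tail (omegaPow T hT) m₀) (tail (omegaPow T hT) w) with he | he
        · exact hp' (he ▸ hlt)
        · exact hp' (hlt.trans ((seqAltLT_or_seqAltLT he).resolve_left hmin))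
      · exact hp' hlt
    · have hp' := h₁.isMin p (by omega)
      rcases hmin with ⟨rfl, hmin⟩ | ⟨rfl, hmin⟩
      · exact hp' hlt
      · exact hp' (hlt.trans hmin)
  have hdone₀ : ∀ j k a b, Small T m₀ j k a b 0 →
      GReach T ((0 + 6 * T.length + 5 + 16 * T.length + 3) + 20 * (5 * T.length) + 2 + 3)
        (cfg (.done (some false)) (regs T.length m₀ j k a b 0) []) fun d =>
      d.label = .fin ∧ ∃ w < T.length, d.reg .i = w ∧ d.out = T.rotate w ∧
        ∀ p, ¬ SeqAltLT (tail (omegaPow T hT) p) (tail (omegaPow T hT) w) := by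
    intro j k a b h
    refine Reach.add (t := _ + 2) rfl h.regs_le (update_regs_first (v := m₀)) ?_
    refine Reach.const (t := _ + 1) rfl (Small.regs_le ?_) (update_regs_i (v := 1)) ?_
    · unfold Small at *; omega
    refine Reach.const rfl (Small.regs_le ?_) (update_regs_j (v := 3)) ?_
    · unfold Small at *; omega
    refine reach_reset (by unfold Small at *; omega) (fun hj => ?_) (fun hj => ?_)
    · exact reach_search (s := true) hT h₁ hm₁ hdone₁ _ (by unfold Small at *; omega) rfl rfl
        (by omega) hj
        (by omega) hn rfl (by simp) (by omega)
    -- Only for `|T| = 1`: the challenger `3` is already out of range.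
    · obtain rfl : m₁ = 1 := by omega
      exact (hdone₁ _ _ _ _ (by unfold Small at *; omega)).mono (by omega)
  refine reach_reset (by unfold Small at *; omega) (fun hj => ?_) (fun hj => ?_)
  · exact reach_search (s := false) hT h₀ hm₀ hdone₀ _ (by unfold Small at *; omega) rfl rfl
        (by omega) hj
      (by omega) hn rfl (by simp) (by omega)
  · obtain rfl : m₀ = 0 := by omega
    exact (hdone₀ _ _ _ _ (by unfold Small at *; omega)).mono (by omega)

end Verification

end GaloisWord

theorem mainTheorem4 :
    ∃ (P : GaloisWord.Program) (C : ℕ),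
      ∀ (α : Type*) [LinearOrder α] (T : List α), GaloisWord.IsPrimitive T →
        ∃ W : List α, GaloisWord.IsGaloisRotation T W ∧
          (∀ W' : List α, GaloisWord.IsGaloisRotation T W' → W' = W) ∧
          ∃ (t : ℕ) (c : GaloisWord.Config P α),
            P.HaltsAt T t c ∧ t ≤ C * T.length ∧ P.RegsBounded T t (C * T.length) ∧
            c.out = W ∧ c.reg P.posReg < T.length ∧ T.rotate (c.reg P.posReg) = W := by
  -- The constant `300` comes from the time bound; the registers need only `10`.
  refine ⟨GaloisWord.galoisProgram, 300, fun α _ T hprim => ?_⟩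
  obtain ⟨t, ht, d, hrun, ⟨hl, w, hw, hi, hout, hmin⟩, hB⟩ :=
    (GaloisWord.reach_galoisRotation hprim.ne_nil).exists_run (t₀ := 0) rfl (by simp)
  have hgal := hprim.isGalois_rotate hmin
  have hrot : T ~r T.rotate w := ⟨w, rfl⟩
  refine ⟨T.rotate w, ⟨hrot, hgal⟩, fun W' hW' => ?_, t, d, ⟨hrun, ?_⟩, by omega, ?_, hout, ?_, ?_⟩
  · exact hgal.eq_of_isRotated hW'.2 (hrot.symm.trans hW'.1)
  · rw [hl]
    rfl
  · exact fun s hs c hc r => (hB s hs c hc r).trans (by omega)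
  · exact hi ▸ hw
  · exact congrArg T.rotate hi
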